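/- Let $H$ be a complex separable infinite-dimensional Hilbert space and let $B(H)$ be the space of bounded linear operators on $H$ with the operator-norm topology; all topological notions below refer to this topology. For $A\in B(H)$ let $N(A)$ and $R(A)$ denote its kernel and range, and let every dimension take values in $\{0,1,2,\ldots,\infty\}$ (all infinite dimensions are identified with $\infty$). For $k\in\{0,1,2,\ldots\}$ put $$\Sigma_k=\{A\in B(H): \dim R(A)=k\},$$ and for $n,m\in\{0,1,2,\ldots,\infty\}$ let $\Sigma^1_{n,m}$ (respectively $\Sigma^0_{n,m}$) be the set of all $A\in B(H)$ such that $\dim N(A)=n$, $\dim R(A)^{\perp}=m$, $\dim\overline{R(A)}=\infty$ and $R(A)$ is closed (respectively not closed). Then the sets $\Sigma_k$, $\Sigma^1_{n,m}$, $\Sigma^0_{n,m}$ are nonempty, pairwise disjoint and cover $B(H)$, and for all $k\in\{0,1,2,\ldots\}$ and $n,m\in\{0,1,2,\ldots,\infty\}$: (a) $\Sigma_k$ is the intersection of an open set and a closed set. (b) If $n$ or $m$ is finite, then $\Sigma^1_{n,m}$ is the intersection of an open set and a closed set; if $n=0$ or $m=0$, then $\Sigma^1_{n,m}$ is open. (c)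 $\Sigma^0_{0,0}$ is $G_\delta$; if $n$ and $m$ are both finite, then $\Sigma^0_{n,m}$ is the intersection of an $F_\sigma$ set and a $G_\delta$ set; if exactly one of $n,m$ is infinite, then $\Sigma^0_{n,m}$ is $F_{\sigma\delta}$ (a countable intersection of $F_\sigma$ sets). (d) $\Sigma^1_{\infty,\infty}$ and $\Sigma^0_{\infty,\infty}$ are Borel sets. -/

import Mathlib

open Set TopologicalSpace
open scoped MeasureTheory

/-- An `F_σ` set: a countable union of closed sets. -/
def IsFsigma {X : Type*} [TopologicalSpace X] (s : Set X) : Prop :=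
  ∃ T : Set (Set X), (∀ t ∈ T, IsClosed t) ∧ T.Countable ∧ s = ⋃₀ T

/-- An `F_{σδ}` set: a countable intersection of `F_σ` sets. -/
def IsFsigmaDelta {X : Type*} [TopologicalSpace X] (s : Set X) : Prop :=
  ∃ T : Set (Set X), (∀ t ∈ T, IsFsigma t) ∧ T.Countable ∧ s = ⋂₀ T

/-- A set of type `F_σ ∩ G_δ`: the intersection of an `F_σ` set and a `G_δ` set. -/
def IsFsigmaInterGdelta {X : Type*} [TopologicalSpace X] (s : Set X) : Prop :=
  ∃ F G : Set X, IsFsigma F ∧ IsGδ G ∧ s = F ∩ G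

/-- The dimension of a complex vector space, in `{0, 1, 2, …, ∞}`
(all infinite dimensions are identified with `∞ = ⊤`). -/
noncomputable def extDim (V : Type*) [AddCommGroup V] [Module ℂ V] : ℕ∞ :=
  Cardinal.toENat (Module.rank ℂ V)

section

variable (H : Type*) [NormedAddCommGroup H] [InnerProductSpace ℂ H]

/-- `Σ_k(H)`: the bounded operators whose range has dimension `k`. -/
def sigmaRank (k : ℕ) : Set (H →L[ℂ] H) :=
  {A | extDim (LinearMap.range A.toLinearMap) = k}

/-- `Σ_{n,m}^1(H)`: the bounded operators `A` with `dim N(A) = n`, `dim R(A)^⊥ = m`,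
`dim (closure R(A)) = ∞` and closed range. -/
def sigmaClosed (n m : ℕ∞) : Set (H →L[ℂ] H) :=
  {A | extDim (LinearMap.ker A.toLinearMap) = n ∧
    extDim ((LinearMap.range A.toLinearMap)ᗮ : Submodule ℂ H) = m ∧
    extDim (LinearMap.range A.toLinearMap).topologicalClosure = ⊤ ∧
    IsClosed (Set.range A)}

/-- `Σ_{n,m}^0(H)`: the bounded operators `A` with `dim N(A) = n`, `dim R(A)^⊥ = m`,
`dim (closure R(A)) = ∞` and nonclosed range. -/
def sigmaNonclosed (n m : ℕ∞) : Set (H →L[ℂ] H) :=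
  {A | extDim (LinearMap.ker A.toLinearMap) = n ∧
    extDim ((LinearMap.range A.toLinearMap)ᗮ : Submodule ℂ H) = m ∧
    extDim (LinearMap.range A.toLinearMap).topologicalClosure = ⊤ ∧
    ¬ IsClosed (Set.range A)}

/-- All the classes as one family, indexed by `k`, by `(n, m)` (closed range) and by
`(n, m)` (nonclosed range). -/
def sigmaFamily : ℕ ⊕ (ℕ∞ × ℕ∞) ⊕ (ℕ∞ × ℕ∞) → Set (H →L[ℂ] H)
  | .inl k => sigmaRank H k
  | .inr (.inl p) => sigmaClosed H p.1 p.2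
  | .inr (.inr p) => sigmaNonclosed H p.1 p.2

end

/-!
Everything is reduced to two descriptions by closed conditions, both obtained from the identity
`(ker A)ᗮ = closure (range A†)`.

* The distance from `x` to `ker A` is at most `r` if and only if `|⟪A x, v⟫| ≤ r ‖A† v‖` for
  all `v` (`exists_mem_ker_norm_sub_le_iff`). Hence `{A | ker A meets closedBall x r}` is closed.
  As linear independence is an open condition, `{A | k ≤ dim ker A}` is a countable union of finite
  intersections of such sets, with centres in a countable dense set: it is `F_σ`
  (`isFsigma_setOf_natCast_le_extDim_ker`). Passing to adjoints, so is
  `{A | k ≤ dim (range A)ᗮ}`.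
* The range of `A` is closed if and only if, for some constant `C`, one has
  `|⟪A x, v⟫| ≤ C ‖A x‖ ‖A† v‖` for all `x` and `v` (`isClosed_range_iff_exists_norm_inner_le`). This
  is a closed condition for each `C`, so the operators with closed range form an `F_σ` set; it is
  symmetric in `A` and `A†`, which gives the closed range theorem as well.

Since `{A | k ≤ dim range A}` is open, the statements on operators with nonclosed range and on the
classes with `n = m = ∞` follow by taking complements and countable intersections.

The classes with closed range and `n` finite need a perturbation argument. If `A₀` has closed range,
its restriction to `(ker A₀)ᗮ` has a bounded left inverse `L`. As long as `L ∘ A` is invertible on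
`(ker A₀)ᗮ`, the image of `(ker A₀)ᗮ` under `A` is a closed complement of `ker L`, and
`ker A ∩ (ker A₀)ᗮ = 0` (`exists_isOpen_forall_map_orthogonal_ker`). If `ker A₀` is
finite-dimensional, this shows that near `A₀` ranges are closed, kernel dimensions do not exceed
`dim ker A₀`, and `dim (range A)ᗮ` is unchanged wherever the kernel dimension is
(`exists_isOpen_forall_extDim_ker_le`). The case of finite `m` follows by passing to adjoints.

Elements of the classes are obtained as `T ∘ D ∘ S†`, where `S` and `T` are isometries whose ranges
have orthogonal complements of dimensions `n` and `m`, and where `D` is the identity or a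
diagonal operator with eigenvalues `2⁻ʲ`.
-/

open scoped InnerProductSpace InnerProduct

/-! ### Borel classes of low order -/

theorem isFsigma_iff_isGδ_compl {X : Type*} [TopologicalSpace X] {s : Set X} :
    IsFsigma s ↔ IsGδ sᶜ := by
  constructor
  · rintro ⟨T, hT, hc, rfl⟩
    rw [compl_sUnion]
    exact IsGδ.sInter (by rintro _ ⟨t, ht, rfl⟩; exact (hT t ht).isOpen_compl.isGδ) (hc.image _)
  · rintro ⟨T, hT, hc, h⟩
    refine ⟨compl '' T, ?_, hc.image _, ?_⟩
    · rintro _ ⟨t, ht, rfl⟩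
      exact (hT t ht).isClosed_compl
    · rw [← compl_sInter, ← h, compl_compl]

theorem IsFsigma.isGδ_compl {X : Type*} [TopologicalSpace X] {s : Set X} (hs : IsFsigma s) :
    IsGδ sᶜ :=
  isFsigma_iff_isGδ_compl.1 hs

theorem IsClosed.isFsigma {X : Type*} [TopologicalSpace X] {s : Set X} (hs : IsClosed s) :
    IsFsigma s :=
  isFsigma_iff_isGδ_compl.2 hs.isOpen_compl.isGδ

theorem IsFsigma.iUnion {X ι : Type*} [TopologicalSpace X] [Countable ι] {s : ι → Set X}
    (hs : ∀ i, IsFsigma (s i)) : IsFsigma (⋃ i, s i) := by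
  rw [isFsigma_iff_isGδ_compl, compl_iUnion]
  exact IsGδ.iInter fun i => (hs i).isGδ_compl

theorem IsFsigma.inter {X : Type*} [TopologicalSpace X] {s t : Set X}
    (hs : IsFsigma s) (ht : IsFsigma t) : IsFsigma (s ∩ t) := by
  rw [isFsigma_iff_isGδ_compl, compl_inter]
  exact hs.isGδ_compl.union ht.isGδ_compl

theorem IsFsigma.preimage {X Y : Type*} [TopologicalSpace X] [TopologicalSpace Y] {f : X → Y}
    {s : Set Y} (hf : Continuous f) (hs : IsFsigma s) : IsFsigma (f ⁻¹' s) :=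
  isFsigma_iff_isGδ_compl.2 (hs.isGδ_compl.preimage hf)

theorem IsFsigma.isFsigmaDelta {X : Type*} [TopologicalSpace X] {s : Set X} (hs : IsFsigma s) :
    IsFsigmaDelta s :=
  ⟨{s}, by simpa using hs, countable_singleton s, by simp⟩

theorem IsFsigmaDelta.iInter_of_isFsigma {X ι : Type*} [TopologicalSpace X] [Countable ι]
    {s : ι → Set X} (hs : ∀ i, IsFsigma (s i)) : IsFsigmaDelta (⋂ i, s i) :=
  ⟨range s, by rintro _ ⟨i, rfl⟩; exact hs i, countable_range s, by simp⟩

theorem IsFsigmaDelta.inter {X : Type*} [TopologicalSpace X] {s t : Set X}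
    (hs : IsFsigmaDelta s) (ht : IsFsigmaDelta t) : IsFsigmaDelta (s ∩ t) := by
  obtain ⟨S, hS, hSc, rfl⟩ := hs
  obtain ⟨T, hT, hTc, rfl⟩ := ht
  exact ⟨S ∪ T, fun u hu => hu.elim (hS u) (hT u), hSc.union hTc, (sInter_union S T).symm⟩

/-- In a metrizable space open sets are `F_σ`, so every `G_δ` set is `F_{σδ}`. -/
theorem IsGδ.isFsigmaDelta {X : Type*} [TopologicalSpace X] [PseudoMetrizableSpace X]
    {s : Set X} (hs : IsGδ s) : IsFsigmaDelta s := by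
  let := pseudoMetrizableSpacePseudoMetric X
  obtain ⟨T, hT, hc, rfl⟩ := hs
  exact ⟨T, fun t ht => isFsigma_iff_isGδ_compl.2 (hT t ht).isClosed_compl.isGδ, hc, rfl⟩

theorem IsFsigma.measurableSet {X : Type*} [TopologicalSpace X] [MeasurableSpace X]
    [BorelSpace X] {s : Set X} (hs : IsFsigma s) : MeasurableSet s :=
  hs.isGδ_compl.measurableSet.of_compl

theorem IsFsigmaDelta.measurableSet {X : Type*} [TopologicalSpace X] [MeasurableSpace X]
    [BorelSpace X] {s : Set X} (hs : IsFsigmaDelta s) : MeasurableSet s := by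
  obtain ⟨T, hT, hc, rfl⟩ := hs
  exact MeasurableSet.sInter hc fun t ht => (hT t ht).measurableSet

theorem IsFsigmaInterGdelta.inter {X : Type*} [TopologicalSpace X] {s t : Set X}
    (hs : IsFsigmaInterGdelta s) (ht : IsFsigmaInterGdelta t) : IsFsigmaInterGdelta (s ∩ t) := by
  obtain ⟨F, G, hF, hG, rfl⟩ := hs
  obtain ⟨F', G', hF', hG', rfl⟩ := ht
  exact ⟨F ∩ F', G ∩ G', hF.inter hF', hG.inter hG', inter_inter_inter_comm _ _ _ _⟩

theorem IsGδ.isFsigmaInterGdelta {X : Type*} [TopologicalSpace X] {s : Set X} (hs : IsGδ s) :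
    IsFsigmaInterGdelta s :=
  ⟨univ, s, isClosed_univ.isFsigma, hs, (univ_inter s).symm⟩

/-! ### Dimensions with values in `ℕ∞` -/

section

variable {V W : Type*} [AddCommGroup V] [Module ℂ V] [AddCommGroup W] [Module ℂ W]

theorem natCast_le_extDim_iff {k : ℕ} :
    (k : ℕ∞) ≤ extDim V ↔ ∃ v : Fin k → V, LinearIndependent ℂ v := by
  rw [extDim, Cardinal.natCast_le_toENat, Module.le_rank_iff]

theorem natCast_le_extDim_submodule_iff {k : ℕ} {p : Submodule ℂ V} :
    (k : ℕ∞) ≤ extDim p ↔ ∃ v : Fin k → V, (∀ i, v i ∈ p) ∧ LinearIndependent ℂ v := by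
  rw [natCast_le_extDim_iff]
  constructor
  · rintro ⟨v, hv⟩
    exact ⟨fun i => v i, fun i => (v i).2,
      hv.map' p.subtype (Submodule.ker_subtype p)⟩
  · rintro ⟨v, hvp, hv⟩
    refine ⟨fun i => ⟨v i, hvp i⟩, ?_⟩
    exact LinearIndependent.of_comp p.subtype hv

theorem extDim_eq_top_iff : extDim V = ⊤ ↔ ¬ FiniteDimensional ℂ V := by
  rw [extDim, Cardinal.toENat_eq_top, ← not_lt, Module.rank_lt_aleph0_iff]

theorem extDim_ne_top_iff : extDim V ≠ ⊤ ↔ FiniteDimensional ℂ V := by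
  rw [Ne, extDim_eq_top_iff, not_not]

theorem extDim_eq_finrank [FiniteDimensional ℂ V] : extDim V = Module.finrank ℂ V := by
  rw [extDim, Cardinal.toENat_eq_natCast, Module.finrank_eq_rank]

end

section

universe u

variable {V W : Type u} [AddCommGroup V] [Module ℂ V] [AddCommGroup W] [Module ℂ W]

theorem LinearEquiv.extDim_eq (e : V ≃ₗ[ℂ] W) : extDim V = extDim W := by
  rw [extDim, extDim, e.rank_eq]

theorem extDim_le_of_injective (f : V →ₗ[ℂ] W) (hf : Function.Injective f) :
    extDim V ≤ extDim W :=
  Cardinal.toENat.monotone' (LinearMap.rank_le_of_injective f hf)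

theorem extDim_mono {p q : Submodule ℂ V} (h : p ≤ q) : extDim p ≤ extDim q :=
  extDim_le_of_injective _ (Submodule.inclusion_injective h)

theorem IsCompl.extDim_quotient_eq {p q : Submodule ℂ V} (h : IsCompl p q) :
    extDim (V ⧸ p) = extDim q :=
  (Submodule.quotientEquivOfIsCompl p q h).extDim_eq

end

theorem isOpen_setOf_natCast_le_extDim_range {H : Type*} [NormedAddCommGroup H]
    [InnerProductSpace ℂ H] (k : ℕ) :
    IsOpen {A : H →L[ℂ] H | (k : ℕ∞) ≤ extDim (LinearMap.range A.toLinearMap)} := by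
  have : {A : H →L[ℂ] H | (k : ℕ∞) ≤ extDim (LinearMap.range A.toLinearMap)} =
      ⋃ x : Fin k → H, (fun A : H →L[ℂ] H => fun i => A (x i)) ⁻¹'
        {v | LinearIndependent ℂ v} := by
    ext A
    simp only [mem_ofPred_eq, natCast_le_extDim_submodule_iff, mem_iUnion, mem_preimage]
    constructor
    · rintro ⟨v, hv, hli⟩
      choose x hx using hv
      obtain rfl : (fun i => A (x i)) = v := funext hx
      exact ⟨x, hli⟩
    · rintro ⟨x, hx⟩
      exact ⟨_, fun i => ⟨x i, rfl⟩, hx⟩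
  rw [this]
  exact isOpen_iUnion fun x => isOpen_setOfPred_linearIndependent.preimage (by fun_prop)

/-! ### Duality, distances to kernels and closed range -/

section

universe u

variable {H : Type u} [NormedAddCommGroup H] [InnerProductSpace ℂ H] [CompleteSpace H]

theorem continuous_adjoint : Continuous fun A : H →L[ℂ] H => A† :=
  LinearIsometryEquiv.continuous _

theorem continuous_adjoint_apply (v : H) : Continuous fun A : H →L[ℂ] H => (A†) v :=
  (ContinuousLinearMap.apply ℂ H v).continuous.comp continuous_adjoint

/-- The distance from `x` to `ker A` is the supremum of `|⟪A x, v⟫| / ‖A† v‖`, because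
`(ker A)ᗮ` is the closure of the range of `A†`. For fixed `x` and `r`, the right-hand side is a
closed condition on `A`, which replaces a weak compactness argument. -/
theorem exists_mem_ker_norm_sub_le_iff (A : H →L[ℂ] H) (x : H) (r : ℝ) (hr : 0 ≤ r) :
    (∃ y, A y = 0 ∧ ‖x - y‖ ≤ r) ↔ ∀ v, ‖⟪A x, v⟫_ℂ‖ ≤ r * ‖(A†) v‖ := by
  constructor
  · rintro ⟨y, hy, hxy⟩ v
    have h1 : ⟪A x, v⟫_ℂ = ⟪x - y, (A†) v⟫_ℂ := by
      rw [ContinuousLinearMap.adjoint_inner_right, map_sub, hy, sub_zero]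
    rw [h1]
    exact (norm_inner_le_norm _ _).trans (by gcongr)
  · intro h
    have : CompleteSpace A.ker := A.isClosed_ker.completeSpace_coe
    have hdec := A.ker.starProjection_add_starProjection_orthogonal x
    set y := A.ker.starProjection x with hy
    set u := A.kerᗮ.starProjection x with hu
    have hyk : y ∈ A.ker := Submodule.starProjection_apply_mem _ _
    have huK : u ∈ A.kerᗮ := Submodule.starProjection_apply_mem _ _
    have key : ∀ w ∈ closure (range (A†)), ‖⟪x, w⟫_ℂ‖ ≤ r * ‖w‖ := by
      have hcl : IsClosed {w : H | ‖⟪x, w⟫_ℂ‖ ≤ r * ‖w‖} :=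
        isClosed_le (by fun_prop) (by fun_prop)
      refine fun w hw => closure_minimal ?_ hcl hw
      rintro _ ⟨v, rfl⟩
      have := h v
      rwa [← ContinuousLinearMap.adjoint_inner_right] at this
    have hu' : u ∈ closure (range (A†)) := by
      have h2 := huK
      rw [A.orthogonal_ker] at h2
      exact h2
    have h3 := key u hu'
    have h4 : ⟪x, u⟫_ℂ = ⟪u, u⟫_ℂ := by
      conv_lhs => rw [← hdec]
      rw [inner_add_left, huK y hyk, zero_add]
    rw [h4, inner_self_eq_norm_sq_to_K] at h3
    have h5 : ‖u‖ * ‖u‖ ≤ r * ‖u‖ := by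
      have : ‖((‖u‖ : ℂ)) ^ 2‖ = ‖u‖ * ‖u‖ := by simp [pow_two]
      exact this ▸ h3
    refine ⟨y, hyk, ?_⟩
    have h6 : x - y = u := by rw [← hdec]; abel
    rw [h6]
    rcases (norm_nonneg u).eq_or_lt with h0 | h0
    · rw [← h0]; exact hr
    · exact le_of_mul_le_mul_right h5 h0

theorem isClosed_setOf_exists_mem_ker_norm_sub_le (x : H) {r : ℝ} (hr : 0 ≤ r) :
    IsClosed {A : H →L[ℂ] H | ∃ y, A y = 0 ∧ ‖x - y‖ ≤ r} := by
  simp only [exists_mem_ker_norm_sub_le_iff _ x r hr, ofPred_forall]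
  refine isClosed_iInter fun v => isClosed_le ?_ ?_
  · fun_prop
  · have := continuous_adjoint_apply v
    fun_prop

/-- The hypothesis bounds `dist(x, ker A)` by `C ‖A x‖`, so `A` is bounded below on `(ker A)ᗮ`. -/
theorem isClosed_range_of_forall_exists_mem_ker {A : H →L[ℂ] H} {C : ℝ}
    (h : ∀ x, ∃ y, A y = 0 ∧ ‖x - y‖ ≤ C * ‖A x‖) : IsClosed (range A) := by
  have : CompleteSpace A.ker := A.isClosed_ker.completeSpace_coe
  have hanti : AntilipschitzWith C.toNNReal (A ∘L A.kerᗮ.subtypeL) := by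
    refine AddMonoidHomClass.antilipschitz_of_bound _ fun x => ?_
    obtain ⟨y, hy, hxy⟩ := h x
    have h1 : ‖(x : H)‖ ≤ ‖(x : H) - y‖ := by
      have h2 : ⟪(x : H), y⟫_ℂ = 0 := Submodule.inner_left_of_mem_orthogonal hy x.2
      have h3 := norm_sub_sq (𝕜 := ℂ) (x : H) y
      rw [h2, map_zero, mul_zero, sub_zero] at h3
      exact (sq_le_sq₀ (norm_nonneg _) (norm_nonneg _)).1 (by nlinarith [sq_nonneg ‖y‖])
    calc ‖x‖ ≤ C * ‖A x‖ := h1.trans hxy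
      _ ≤ _ := by
        gcongr
        · exact Real.le_coe_toNNReal C
        · simp
  have hr : range (A ∘L A.kerᗮ.subtypeL) = range A := by
    refine subset_antisymm ?_ ?_
    · rintro _ ⟨x, rfl⟩
      exact ⟨x, rfl⟩
    · rintro _ ⟨x, rfl⟩
      refine ⟨⟨A.kerᗮ.starProjection x, Submodule.starProjection_apply_mem _ _⟩, ?_⟩
      have hdec := A.ker.starProjection_add_starProjection_orthogonal x
      have hy : A (A.ker.starProjection x) = 0 := Submodule.starProjection_apply_mem A.ker x
      conv_rhs => rw [← hdec, map_add, hy, zero_add]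
      rfl
  rw [← hr]
  exact hanti.isClosed_range (A ∘L A.kerᗮ.subtypeL).uniformContinuous

/-- Closedness of the range expressed by a condition that is symmetric in `A` and `A†` and closed
in `A` for each constant `C`. -/
theorem isClosed_range_iff_exists_norm_inner_le (A : H →L[ℂ] H) :
    IsClosed (range A) ↔
      ∃ C : ℕ, ∀ x v, ‖⟪A x, v⟫_ℂ‖ ≤ C * ‖A x‖ * ‖(A†) v‖ := by
  constructor
  · intro h
    have : CompleteSpace A.range := by
      have h' : IsClosed (A.range : Set H) := h
      exact h'.completeSpace_coe
    obtain ⟨C, hC, hb⟩ := A.rangeRestrict.exists_preimage_norm_le (by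
      rintro ⟨_, x, rfl⟩
      exact ⟨x, rfl⟩)
    obtain ⟨N, hN⟩ := exists_nat_ge C
    refine ⟨N, fun x => ?_⟩
    rw [← exists_mem_ker_norm_sub_le_iff A x _ (by positivity)]
    obtain ⟨z, hz, hzn⟩ := hb (A.rangeRestrict x)
    have hz' : A z = A x := congrArg Subtype.val hz
    refine ⟨x - z, by rw [map_sub, hz', sub_self], ?_⟩
    rw [sub_sub_cancel]
    refine hzn.trans ?_
    change C * ‖A x‖ ≤ _
    gcongr
  · rintro ⟨C, hC⟩
    refine isClosed_range_of_forall_exists_mem_ker (C := C) fun x => ?_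
    rw [exists_mem_ker_norm_sub_le_iff A x _ (by positivity)]
    exact hC x

theorem isClosed_range_adjoint_iff (A : H →L[ℂ] H) :
    IsClosed (range (A†)) ↔ IsClosed (range A) := by
  rw [isClosed_range_iff_exists_norm_inner_le, isClosed_range_iff_exists_norm_inner_le]
  refine exists_congr fun C => ?_
  rw [forall_comm]
  refine forall_congr' fun x => forall_congr' fun v => ?_
  rw [ContinuousLinearMap.adjoint_adjoint, ContinuousLinearMap.adjoint_inner_left,
    norm_inner_symm, mul_right_comm]

theorem isFsigma_setOf_isClosed_range : IsFsigma {A : H →L[ℂ] H | IsClosed (range A)} := by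
  simp only [isClosed_range_iff_exists_norm_inner_le, ofPred_exists, ofPred_forall]
  refine IsFsigma.iUnion fun C => IsClosed.isFsigma ?_
  refine isClosed_iInter fun x => isClosed_iInter fun v => isClosed_le (by fun_prop) ?_
  have := continuous_adjoint_apply v
  fun_prop

/-! ### Sets defined by lower bounds on dimensions -/

/-- Linear independence is an open condition, so a linearly independent `k`-tuple in `ker A` can be
localized in a product of small closed balls centred at points of a fixed dense sequence, such that
every `k`-tuple in that product is linearly independent. -/
theorem isFsigma_setOf_natCast_le_extDim_ker [SeparableSpace H] (k : ℕ) :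
    IsFsigma {A : H →L[ℂ] H | (k : ℕ∞) ≤ extDim (LinearMap.ker A.toLinearMap)} := by
  let d := denseSeq H
  let I := {p : (Fin k → ℕ) × ℕ // ∀ v : Fin k → H,
    (∀ i, ‖d (p.1 i) - v i‖ ≤ 1 / ((p.2 : ℝ) + 1)) → LinearIndependent ℂ v}
  have : {A : H →L[ℂ] H | (k : ℕ∞) ≤ extDim (LinearMap.ker A.toLinearMap)} =
      ⋃ p : I, ⋂ i : Fin k,
        {A : H →L[ℂ] H | ∃ y, A y = 0 ∧ ‖d (p.1.1 i) - y‖ ≤ 1 / ((p.1.2 : ℝ) + 1)} := by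
    ext A
    simp only [mem_ofPred_eq, natCast_le_extDim_submodule_iff, mem_iUnion, mem_iInter]
    constructor
    · rintro ⟨v, hv, hli⟩
      obtain ⟨ε, hε, hball⟩ := Metric.isOpen_iff.1
        (isOpen_setOfPred_linearIndependent (𝕜 := ℂ) (E := H) (ι := Fin k)) v hli
      obtain ⟨N, hN⟩ := exists_nat_one_div_lt (half_pos hε)
      have hN0 : 0 < 1 / ((N : ℝ) + 1) := Nat.one_div_pos_of_nat
      have hd : ∀ i, ∃ j, dist (v i) (d j) < 1 / ((N : ℝ) + 1) := fun i => 
        (denseRange_denseSeq H).exists_dist_lt (v i) hN0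
      choose j hj using hd
      refine ⟨⟨(j, N), fun w hw => hball ?_⟩, fun i => ⟨v i, hv i, ?_⟩⟩
      · rw [Metric.mem_ball, dist_pi_lt_iff hε]
        intro i
        calc dist (w i) (v i) ≤ dist (w i) (d (j i)) + dist (v i) (d (j i)) :=
              dist_triangle_right _ _ _
          _ < ε := by
              have h1 := hw i
              rw [← dist_eq_norm, dist_comm] at h1
              have h2 := hj i
              simp only at h1
              linarith
      · rw [← dist_eq_norm, dist_comm]
        exact (hj i).le
    · rintro ⟨p, hp⟩
      choose y hy hyd using hp
      exact ⟨y, hy, p.2 y hyd⟩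
  rw [this]
  have : Countable I := Subtype.countable
  exact IsFsigma.iUnion fun p => IsClosed.isFsigma <| isClosed_iInter fun i =>
    isClosed_setOf_exists_mem_ker_norm_sub_le _ Nat.one_div_pos_of_nat.le

theorem isFsigma_setOf_natCast_le_extDim_orthogonal_range [SeparableSpace H] (k : ℕ) :
    IsFsigma {A : H →L[ℂ] H |
      (k : ℕ∞) ≤ extDim ((LinearMap.range A.toLinearMap)ᗮ : Submodule ℂ H)} := by
  have h := (isFsigma_setOf_natCast_le_extDim_ker (H := H) k).preimage
    continuous_adjoint
  refine (congrArg IsFsigma (Set.ext fun A => ?_)).mpr h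
  change _ ≤ extDim _ ↔ _ ≤ extDim (A†).ker
  rw [← A.orthogonal_range]

end

/-! ### Perturbation of operators with closed range and finite-dimensional kernel -/

theorem isCompl_range_ker_of_isUnit_comp {E F : Type*} [NormedAddCommGroup E] [NormedSpace ℂ E]
    [NormedAddCommGroup F] [NormedSpace ℂ F] {T : E →L[ℂ] F} {L : F →L[ℂ] E}
    (h : IsUnit (L ∘L T)) : IsCompl T.range L.ker := by
  obtain ⟨u, hu⟩ := h
  have h1 : ∀ x, (↑u⁻¹ : E →L[ℂ] E) (L (T x)) = x := fun x => by
    have := congrArg (fun f : E →L[ℂ] E => f x) u.inv_mul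
    rw [hu] at this
    exact this
  have h2 : ∀ x, L (T ((↑u⁻¹ : E →L[ℂ] E) x)) = x := fun x => by
    have := congrArg (fun f : E →L[ℂ] E => f x) u.mul_inv
    rw [hu] at this
    exact this
  refine IsCompl.of_eq ?_ ?_
  · rw [Submodule.eq_bot_iff]
    rintro _ ⟨⟨x, rfl⟩, hx⟩
    have h3 : L (T x) = 0 := hx
    have h4 := h1 x
    rw [h3, map_zero] at h4
    rw [← h4, map_zero]
  · rw [Submodule.eq_top_iff']
    intro y
    rw [Submodule.mem_sup]
    refine ⟨T ((↑u⁻¹ : E →L[ℂ] E) (L y)), ⟨_, rfl⟩, y - T ((↑u⁻¹ : E →L[ℂ] E) (L y)), ?_, by simp⟩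
    change L _ = 0
    rw [map_sub, h2, sub_self]

theorem hasLeftInverse_of_isUnit_comp {E F : Type*} [NormedAddCommGroup E] [NormedSpace ℂ E]
    [NormedAddCommGroup F] [NormedSpace ℂ F] {T : E →L[ℂ] F} {L : F →L[ℂ] E}
    (h : IsUnit (L ∘L T)) : T.HasLeftInverse := by
  obtain ⟨u, hu⟩ := h
  refine ⟨(↑u⁻¹ : E →L[ℂ] E) ∘L L, fun x => ?_⟩
  have := congrArg (fun f : E →L[ℂ] E => f x) u.inv_mul
  rw [hu] at this
  exact this

theorem extDim_closure_range_eq_top_of_ker {H : Type*} [NormedAddCommGroup H]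
    [InnerProductSpace ℂ H] (hH : ¬ FiniteDimensional ℂ H) (A : H →L[ℂ] H)
    (h : extDim A.ker ≠ ⊤) : extDim A.range.topologicalClosure = ⊤ := by
  rw [extDim_ne_top_iff] at h
  rw [extDim_eq_top_iff]
  intro h'
  have : FiniteDimensional ℂ A.range :=
    Submodule.finiteDimensional_of_le A.range.le_topologicalClosure
  have : FiniteDimensional ℂ (H ⧸ A.ker) :=
    A.toLinearMap.quotKerEquivRange.symm.finiteDimensional
  exact hH (Module.Finite.of_submodule_quotient A.ker)

section

universe u

variable {H : Type u} [NormedAddCommGroup H] [InnerProductSpace ℂ H] [CompleteSpace H]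

/-- If `A₀` has closed range, its restriction to `(ker A₀)ᗮ` has a bounded left inverse `L`. For
all `A` such that `L ∘ A` is still invertible on `(ker A₀)ᗮ`, the image of `(ker A₀)ᗮ` under `A` is
closed and complementary to the fixed subspace `ker L`, so its codimension is constant. -/
theorem exists_isOpen_forall_map_orthogonal_ker {A₀ : H →L[ℂ] H} (h₀ : IsClosed (range A₀)) :
    ∃ U : Set (H →L[ℂ] H), IsOpen U ∧ A₀ ∈ U ∧ ∃ d : ℕ∞, ∀ A ∈ U,
      Disjoint A.ker A₀.kerᗮ ∧
      IsClosed (A₀.kerᗮ.map A.toLinearMap : Set H) ∧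
      extDim ((A₀.kerᗮ.map A.toLinearMap)ᗮ : Submodule ℂ H) = d := by
  have : CompleteSpace A₀.ker := A₀.isClosed_ker.completeSpace_coe
  let res : (H →L[ℂ] H) → (A₀.kerᗮ →L[ℂ] H) := fun A => A ∘L A₀.kerᗮ.subtypeL
  have hrange : ∀ A, (res A).range = A₀.kerᗮ.map A.toLinearMap := fun A => by
    have h1 : (res A).toLinearMap = A.toLinearMap ∘ₗ A₀.kerᗮ.subtype := rfl
    rw [h1, LinearMap.range_comp, Submodule.range_subtype]
  have hmap : A₀.kerᗮ.map A₀.toLinearMap = A₀.range := by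
    refine le_antisymm LinearMap.map_le_range ?_
    rintro _ ⟨x, rfl⟩
    have hdec := A₀.ker.starProjection_add_starProjection_orthogonal x
    have hy : A₀ (A₀.ker.starProjection x) = 0 := Submodule.starProjection_apply_mem A₀.ker x
    refine ⟨A₀.kerᗮ.starProjection x, Submodule.starProjection_apply_mem _ _, ?_⟩
    change A₀ _ = A₀ x
    conv_rhs => rw [← hdec, map_add, hy, zero_add]
  have hinj : Function.Injective (res A₀) := by
    rw [injective_iff_map_eq_zero]
    intro x hx
    have hx' : (x : H) ∈ A₀.ker := hx
    exact Subtype.ext (A₀.ker.orthogonal_disjoint.le_bot ⟨hx', x.2⟩)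
  have hcl : IsClosed ((res A₀).range : Set H) := by
    rw [hrange, hmap]
    exact h₀
  have hcompl : (res A₀).HasLeftInverse := by
    refine ContinuousLinearMap.HasLeftInverse.of_injective_of_isClosed_range_of_closedComplement_range
      hinj hcl ?_
    have : CompleteSpace (res A₀).range := hcl.completeSpace_coe
    exact ⟨(res A₀).range.orthogonalProjectionOnto,
      Submodule.orthogonalProjectionOnto_mem_subspace_eq_self⟩
  obtain ⟨L, hL⟩ := hcompl
  refine ⟨{A | IsUnit (L ∘L res A)}, ?_, ?_, extDim L.ker, ?_⟩
  · exact Units.isOpen.preimage (f := fun A => L ∘L res A) (by fun_prop)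
  · have : L ∘L res A₀ = 1 := by
      ext1 x
      exact hL x
    change IsUnit _
    rw [this]
    exact isUnit_one
  · intro A hA
    have hleft := hasLeftInverse_of_isUnit_comp hA
    have hclA : IsClosed ((res A).range : Set H) := hleft.isClosed_range
    have hc := isCompl_range_ker_of_isUnit_comp hA
    have : CompleteSpace (res A).range := hclA.completeSpace_coe
    rw [← hrange]
    refine ⟨?_, hclA, ?_⟩
    · rw [Submodule.disjoint_def]
      intro x hx hxM
      have h3 : res A ⟨x, hxM⟩ = res A 0 := by
        rw [map_zero]
        exact hx
      exact congrArg Subtype.val (hleft.injective h3)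
    · rw [← hc.extDim_quotient_eq]
      exact ((Submodule.isCompl_orthogonal _).extDim_quotient_eq).symm

/-- Semicontinuity of the kernel dimension at `A₀`, together with the part of the stability of the
index that concerns operators whose kernel has the same dimension as `ker A₀`. -/
theorem exists_isOpen_forall_extDim_ker_le {A₀ : H →L[ℂ] H} (h₀ : IsClosed (range A₀))
    [FiniteDimensional ℂ A₀.ker] :
    ∃ U : Set (H →L[ℂ] H), IsOpen U ∧ A₀ ∈ U ∧ ∀ A ∈ U,
      IsClosed (range A) ∧ extDim A.ker ≤ extDim A₀.ker ∧
      (extDim A.ker = extDim A₀.ker →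
        extDim (A.rangeᗮ : Submodule ℂ H) = extDim (A₀.rangeᗮ : Submodule ℂ H)) := by
  obtain ⟨U, hU, hA₀, d, hd⟩ := exists_isOpen_forall_map_orthogonal_ker h₀
  have hsup : A₀.ker ⊔ A₀.kerᗮ = ⊤ := Submodule.sup_orthogonal_of_hasOrthogonalProjection
  let f : ∀ A : H →L[ℂ] H, A.ker →ₗ[ℂ] A₀.ker := fun A =>
    A₀.ker.orthogonalProjectionOnto.toLinearMap ∘ₗ A.ker.subtype
  have hf : ∀ A ∈ U, Function.Injective (f A) := by
    intro A hA
    rw [injective_iff_map_eq_zero]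
    intro x hx
    have hx' : (x : H) ∈ A₀.kerᗮ := Submodule.orthogonalProjectionOnto_eq_zero_iff.1 hx
    exact Subtype.ext ((Submodule.disjoint_def.1 (hd A hA).1) x x.2 hx')
  -- When the kernels have equal dimension, `ker A` is a complement of `(ker A₀)ᗮ`.
  have hr : ∀ A ∈ U, extDim A.ker = extDim A₀.ker →
      A.range = A₀.kerᗮ.map A.toLinearMap := by
    intro A hA hdim
    have hfin : FiniteDimensional ℂ A.ker := FiniteDimensional.of_injective (f A) (hf A hA)
    rw [extDim_eq_finrank, extDim_eq_finrank, Nat.cast_inj] at hdim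
    have hsurj := (LinearMap.injective_iff_surjective_of_finrank_eq_finrank hdim).1 (hf A hA)
    refine le_antisymm ?_ LinearMap.map_le_range
    rintro _ ⟨x, rfl⟩
    obtain ⟨y, hy⟩ := hsurj (A₀.ker.orthogonalProjectionOnto x)
    refine ⟨x - y, ?_, ?_⟩
    · rw [SetLike.mem_coe, ← Submodule.orthogonalProjectionOnto_eq_zero_iff, map_sub, sub_eq_zero]
      exact hy.symm
    · have : A y = 0 := y.2
      change A (x - y) = A x
      rw [map_sub, this, sub_zero]
  refine ⟨U, hU, hA₀, fun A hA => ⟨?_, extDim_le_of_injective _ (hf A hA), fun hdim => ?_⟩⟩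
  · have h1 : A.range = A₀.kerᗮ.map A.toLinearMap ⊔ A₀.ker.map A.toLinearMap := by
      rw [← Submodule.map_sup, sup_comm, hsup, Submodule.map_top]
    have h2 : IsClosed (A.range : Set H) := by
      rw [h1]
      exact Submodule.isClosed_sup_finiteDimensional _ _ (hd A hA).2.1
    exact h2
  · rw [hr A hA hdim, hr A₀ hA₀ rfl, (hd A hA).2.2, (hd A₀ hA₀).2.2]

theorem extDim_closure_range_eq_top (hH : ¬ FiniteDimensional ℂ H) (A : H →L[ℂ] H)
    (h : extDim (A.rangeᗮ : Submodule ℂ H) ≠ ⊤) :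
    extDim A.range.topologicalClosure = ⊤ := by
  rw [extDim_ne_top_iff] at h
  rw [extDim_eq_top_iff]
  intro h'
  have : CompleteSpace A.range.topologicalClosure :=
    A.range.isClosed_topologicalClosure.completeSpace_coe
  have hsup : A.range.topologicalClosure ⊔ A.range.topologicalClosureᗮ = ⊤ :=
    Submodule.sup_orthogonal_of_hasOrthogonalProjection
  rw [Submodule.orthogonal_closure] at hsup
  have : FiniteDimensional ℂ (⊤ : Submodule ℂ H) := hsup ▸ inferInstance
  exact hH (Module.finite_def.2 (Module.Finite.iff_fg.1 this))

end

/-! ### Level sets of a dimension function whose superlevel sets are `F_σ` -/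

theorem setOf_natCast_eq {X : Type*} (f : X → ℕ∞) (k : ℕ) :
    {x | f x = k} = {x | (k : ℕ∞) ≤ f x} ∩ {x | ((k + 1 : ℕ) : ℕ∞) ≤ f x}ᶜ := by
  ext x
  change f x = k ↔ (k : ℕ∞) ≤ f x ∧ ¬ ((k + 1 : ℕ) : ℕ∞) ≤ f x
  generalize f x = a
  rw [Nat.cast_add, Nat.cast_one, not_le, ENat.lt_add_one_iff (ENat.natCast_ne_top k),
    le_antisymm_iff, and_comm]

theorem setOf_eq_top {X : Type*} (f : X → ℕ∞) :
    {x | f x = ⊤} = ⋂ k : ℕ, {x | (k : ℕ∞) ≤ f x} := by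
  ext x
  rw [mem_iInter]
  exact ENat.eq_top_iff_forall_ge

theorem isFsigmaDelta_setOf_eq {X : Type*} [TopologicalSpace X] [PseudoMetrizableSpace X]
    {f : X → ℕ∞} (hf : ∀ k : ℕ, IsFsigma {x | (k : ℕ∞) ≤ f x}) (n : ℕ∞) :
    IsFsigmaDelta {x | f x = n} := by
  induction n with
  | top =>
    rw [setOf_eq_top]
    exact IsFsigmaDelta.iInter_of_isFsigma hf
  | coe k =>
    rw [setOf_natCast_eq]
    exact (hf k).isFsigmaDelta.inter (hf (k + 1)).isGδ_compl.isFsigmaDelta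

theorem isGδ_setOf_eq_zero {X : Type*} [TopologicalSpace X]
    {f : X → ℕ∞} (hf : ∀ k : ℕ, IsFsigma {x | (k : ℕ∞) ≤ f x}) :
    IsGδ {x | f x = 0} := by
  have h := setOf_natCast_eq f 0
  rw [Nat.cast_zero] at h
  rw [h]
  have h0 : {x | (0 : ℕ∞) ≤ f x} = univ := eq_univ_of_forall fun x => zero_le (a := f x)
  rw [h0, univ_inter]
  exact (hf _).isGδ_compl

theorem isFsigmaInterGdelta_setOf_eq {X : Type*} [TopologicalSpace X]
    {f : X → ℕ∞} (hf : ∀ k : ℕ, IsFsigma {x | (k : ℕ∞) ≤ f x}) {n : ℕ∞} (hn : n ≠ ⊤) :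
    IsFsigmaInterGdelta {x | f x = n} := by
  lift n to ℕ using hn
  exact ⟨_, _, hf n, (hf (n + 1)).isGδ_compl, setOf_natCast_eq f n⟩

/-! ### Operators with infinite-dimensional range -/

section

variable {H : Type*} [NormedAddCommGroup H] [InnerProductSpace ℂ H]

theorem extDim_topologicalClosure_eq_top_iff (p : Submodule ℂ H) :
    extDim p.topologicalClosure = ⊤ ↔ extDim p = ⊤ := by
  refine ⟨fun h => ?_, fun h => top_le_iff.1 (h ▸ extDim_mono p.le_topologicalClosure)⟩
  rw [extDim_eq_top_iff] at h ⊢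
  intro hp
  rw [p.closed_of_finiteDimensional.submodule_topologicalClosure_eq] at h
  exact h hp

theorem isGδ_setOf_extDim_closure_range_eq_top :
    IsGδ {A : H →L[ℂ] H | extDim A.range.topologicalClosure = ⊤} := by
  simp only [extDim_topologicalClosure_eq_top_iff]
  rw [setOf_eq_top]
  exact IsGδ.iInter_of_isOpen isOpen_setOf_natCast_le_extDim_range

theorem sigmaNonclosed_eq (n m : ℕ∞) :
    sigmaNonclosed H n m = {A : H →L[ℂ] H | extDim A.ker = n} ∩
      {A : H →L[ℂ] H | extDim (A.rangeᗮ : Submodule ℂ H) = m} ∩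
      ({A : H →L[ℂ] H | extDim A.range.topologicalClosure = ⊤} ∩
        {A : H →L[ℂ] H | IsClosed (range A)}ᶜ) := by
  rw [inter_assoc]
  rfl

theorem sigmaClosed_eq (n m : ℕ∞) :
    sigmaClosed H n m = {A : H →L[ℂ] H | extDim A.ker = n} ∩
      {A : H →L[ℂ] H | extDim (A.rangeᗮ : Submodule ℂ H) = m} ∩
      ({A : H →L[ℂ] H | extDim A.range.topologicalClosure = ⊤} ∩
        {A : H →L[ℂ] H | IsClosed (range A)}) := by
  rw [inter_assoc]
  rfl

end

/-! ### Topological type of the classes -/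

section

universe u

variable {H : Type u} [NormedAddCommGroup H] [InnerProductSpace ℂ H]

theorem isLocallyClosed_sigmaRank (k : ℕ) : IsLocallyClosed (sigmaRank H k) :=
  ⟨_, _, isOpen_setOf_natCast_le_extDim_range k,
    (isOpen_setOf_natCast_le_extDim_range (k + 1)).isClosed_compl,
    setOf_natCast_eq (fun A : H →L[ℂ] H => extDim A.range) k⟩

variable [CompleteSpace H]

/-- Since one of the indices is finite, the infinite-dimensionality of the closure of the range is
automatic for both `A` and `A†`. -/
theorem mem_sigmaClosed_adjoint_iff (hH : ¬ FiniteDimensional ℂ H) {n m : ℕ∞} (hn : n ≠ ⊤)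
    (A : H →L[ℂ] H) : A† ∈ sigmaClosed H n m ↔ A ∈ sigmaClosed H m n := by
  have h1 : A.rangeᗮ = (A†).ker := A.orthogonal_range
  have h2 : (A†).rangeᗮ = A.ker := by
    rw [(A†).orthogonal_range, ContinuousLinearMap.adjoint_adjoint]
  change extDim (A†).ker = n ∧ extDim ((A†).rangeᗮ : Submodule ℂ H) = m ∧
    extDim (A†).range.topologicalClosure = ⊤ ∧ IsClosed (range (A†)) ↔
    extDim A.ker = m ∧ extDim (A.rangeᗮ : Submodule ℂ H) = n ∧
    extDim A.range.topologicalClosure = ⊤ ∧ IsClosed (range A)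
  rw [isClosed_range_adjoint_iff, h2, h1]
  constructor
  · rintro ⟨h3, h4, -, h6⟩
    exact ⟨h4, h3, extDim_closure_range_eq_top hH A (by rwa [h1, h3]), h6⟩
  · rintro ⟨h3, h4, -, h6⟩
    exact ⟨h4, h3, extDim_closure_range_eq_top_of_ker hH (A†) (by rwa [h4]), h6⟩

theorem sigmaClosed_eq_preimage_adjoint (hH : ¬ FiniteDimensional ℂ H) {n m : ℕ∞} (hm : m ≠ ⊤) :
    sigmaClosed H n m = (fun A : H →L[ℂ] H => A†) ⁻¹' sigmaClosed H m n :=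
  Set.ext fun A => (mem_sigmaClosed_adjoint_iff hH hm A).symm

/-- It is shown that every point of the class has an open neighbourhood `U` such that points of `U`
in the closure of the class belong to the class. -/
theorem isLocallyClosed_sigmaClosed_of_ker (hH : ¬ FiniteDimensional ℂ H) {n : ℕ∞} (hn : n ≠ ⊤)
    (m : ℕ∞) : IsLocallyClosed (sigmaClosed H n m) := by
  refine ((isLocallyClosed_tfae _).out 0 3).2 ?_
  rintro A₀ ⟨hker, hran, -, hcl⟩
  have hfin : FiniteDimensional ℂ A₀.ker :=
    extDim_ne_top_iff.1 (hker.trans_ne hn)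
  obtain ⟨U, hU, hA₀, h⟩ := exists_isOpen_forall_extDim_ker_le hcl
  refine ⟨U, hA₀, hU, ?_⟩
  rintro A ⟨hAU, hA⟩
  obtain ⟨hAcl, hAle, hAeq⟩ := h A hAU
  have hAfin : FiniteDimensional ℂ A.ker :=
    extDim_ne_top_iff.1 ((hAle.trans_lt (hker.trans_lt hn.lt_top)).ne)
  -- `B` lies in the class and close enough to `A` that `n = dim ker B ≤ dim ker A`.
  obtain ⟨V, hV, hAV, hV'⟩ := exists_isOpen_forall_extDim_ker_le hAcl
  obtain ⟨B, hBV, hB⟩ := mem_closure_iff.1 hA V hV hAV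
  have hdim : extDim A.ker = n := le_antisymm (hAle.trans hker.le) (hB.1 ▸ (hV' B hBV).2.1)
  exact ⟨hdim, (hAeq (hdim.trans hker.symm)).trans hran,
    extDim_closure_range_eq_top_of_ker hH A (hdim.trans_ne hn), hAcl⟩

theorem isOpen_sigmaClosed_zero (hH : ¬ FiniteDimensional ℂ H) (m : ℕ∞) :
    IsOpen (sigmaClosed H 0 m) := by
  rw [isOpen_iff_mem_nhds]
  rintro A₀ ⟨hker, hran, -, hcl⟩
  have hfin : FiniteDimensional ℂ A₀.ker :=
    extDim_ne_top_iff.1 (hker.trans_ne (by simp))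
  obtain ⟨U, hU, hA₀, h⟩ := exists_isOpen_forall_extDim_ker_le hcl
  refine Filter.mem_of_superset (hU.mem_nhds hA₀) fun A hA => ?_
  obtain ⟨hAcl, hAle, hAeq⟩ := h A hA
  have hdim : extDim A.ker = 0 := le_antisymm (hAle.trans hker.le) zero_le
  exact ⟨hdim, (hAeq (hdim.trans hker.symm)).trans hran,
    extDim_closure_range_eq_top_of_ker hH A (hdim.trans_ne (by simp)), hAcl⟩

theorem isLocallyClosed_sigmaClosed (hH : ¬ FiniteDimensional ℂ H) {n m : ℕ∞}
    (h : n ≠ ⊤ ∨ m ≠ ⊤) : IsLocallyClosed (sigmaClosed H n m) := by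
  rcases h with h | h
  · exact isLocallyClosed_sigmaClosed_of_ker hH h m
  · rw [sigmaClosed_eq_preimage_adjoint hH h]
    exact (isLocallyClosed_sigmaClosed_of_ker hH h n).preimage continuous_adjoint

theorem isOpen_sigmaClosed (hH : ¬ FiniteDimensional ℂ H) {n m : ℕ∞}
    (h : n = 0 ∨ m = 0) : IsOpen (sigmaClosed H n m) := by
  rcases h with rfl | rfl
  · exact isOpen_sigmaClosed_zero hH m
  · rw [sigmaClosed_eq_preimage_adjoint hH (by simp)]
    exact (isOpen_sigmaClosed_zero hH n).preimage continuous_adjoint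

theorem isGδ_setOf_nonclosed_range :
    IsGδ ({A : H →L[ℂ] H | extDim A.range.topologicalClosure = ⊤} ∩
      {A : H →L[ℂ] H | IsClosed (range A)}ᶜ) :=
  isGδ_setOf_extDim_closure_range_eq_top.inter isFsigma_setOf_isClosed_range.isGδ_compl

variable [SeparableSpace H]

theorem isGδ_sigmaNonclosed_zero_zero : IsGδ (sigmaNonclosed H 0 0) := by
  rw [sigmaNonclosed_eq]
  exact ((isGδ_setOf_eq_zero isFsigma_setOf_natCast_le_extDim_ker).inter
    (isGδ_setOf_eq_zero isFsigma_setOf_natCast_le_extDim_orthogonal_range)).inter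
    isGδ_setOf_nonclosed_range

theorem isFsigmaInterGdelta_sigmaNonclosed {n m : ℕ∞} (hn : n ≠ ⊤) (hm : m ≠ ⊤) :
    IsFsigmaInterGdelta (sigmaNonclosed H n m) := by
  rw [sigmaNonclosed_eq]
  exact ((isFsigmaInterGdelta_setOf_eq isFsigma_setOf_natCast_le_extDim_ker hn).inter
    (isFsigmaInterGdelta_setOf_eq isFsigma_setOf_natCast_le_extDim_orthogonal_range hm)).inter
    isGδ_setOf_nonclosed_range.isFsigmaInterGdelta

theorem isFsigmaDelta_sigmaNonclosed (n m : ℕ∞) : IsFsigmaDelta (sigmaNonclosed H n m) := by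
  rw [sigmaNonclosed_eq]
  exact ((isFsigmaDelta_setOf_eq isFsigma_setOf_natCast_le_extDim_ker n).inter
    (isFsigmaDelta_setOf_eq isFsigma_setOf_natCast_le_extDim_orthogonal_range m)).inter
    isGδ_setOf_nonclosed_range.isFsigmaDelta

theorem isFsigmaDelta_sigmaClosed (n m : ℕ∞) : IsFsigmaDelta (sigmaClosed H n m) := by
  rw [sigmaClosed_eq]
  exact ((isFsigmaDelta_setOf_eq isFsigma_setOf_natCast_le_extDim_ker n).inter
    (isFsigmaDelta_setOf_eq isFsigma_setOf_natCast_le_extDim_orthogonal_range m)).inter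
    (isGδ_setOf_extDim_closure_range_eq_top.isFsigmaDelta.inter
      isFsigma_setOf_isClosed_range.isFsigmaDelta)

end

/-! ### The classes form a partition -/

section

variable {H : Type*} [NormedAddCommGroup H] [InnerProductSpace ℂ H]

theorem pairwise_disjoint_sigmaFamily :
    Pairwise fun i j => Disjoint (sigmaFamily H i) (sigmaFamily H j) := by
  have hrank : ∀ (A : H →L[ℂ] H) (k : ℕ), extDim A.range = k →
      extDim A.range.topologicalClosure = ⊤ → False := by
    intro A k hk htop
    rw [extDim_topologicalClosure_eq_top_iff, hk] at htop
    exact ENat.natCast_ne_top k htop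
  intro i j hij
  rw [Set.disjoint_left]
  intro A hi hj
  apply hij
  rcases i with k | ⟨n, m⟩ | ⟨n, m⟩ <;> rcases j with k' | ⟨n', m'⟩ | ⟨n', m'⟩
  · exact congrArg Sum.inl (Nat.cast_inj.1 (hi.symm.trans hj))
  · exact (hrank A k hi hj.2.2.1).elim
  · exact (hrank A k hi hj.2.2.1).elim
  · exact (hrank A k' hj hi.2.2.1).elim
  · obtain rfl : n = n' := hi.1.symm.trans hj.1
    obtain rfl : m = m' := hi.2.1.symm.trans hj.2.1
    rfl
  · exact (hj.2.2.2 hi.2.2.2).elim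
  · exact (hrank A k' hj hi.2.2.1).elim
  · exact (hi.2.2.2 hj.2.2.2).elim
  · obtain rfl : n = n' := hi.1.symm.trans hj.1
    obtain rfl : m = m' := hi.2.1.symm.trans hj.2.1
    rfl

theorem iUnion_sigmaFamily : ⋃ i, sigmaFamily H i = univ := by
  refine eq_univ_of_forall fun A => mem_iUnion.2 ?_
  by_cases h : extDim A.range = ⊤
  · have h' := (extDim_topologicalClosure_eq_top_iff A.range).2 h
    by_cases hc : IsClosed (range A)
    · exact ⟨.inr (.inl (_, _)), rfl, rfl, h', hc⟩
    · exact ⟨.inr (.inr (_, _)), rfl, rfl, h', hc⟩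
  · obtain ⟨k, hk⟩ := ENat.ne_top_iff_exists.1 h
    exact ⟨.inl k, hk.symm⟩

end

/-! ### Nonemptiness of the classes -/

theorem Orthonormal.countable_index {E ι : Type*} [NormedAddCommGroup E] [InnerProductSpace ℂ E]
    [SeparableSpace E] {v : ι → E} (hv : Orthonormal ℂ v) : Countable ι := by
  -- Distinct members are at distance `√2`, so the balls of radius `1/2` around them are disjoint.
  refine Pairwise.countable_of_isOpen_disjoint (s := fun i => Metric.ball (v i) (1 / 2)) ?_
    (fun _ => Metric.isOpen_ball) (fun i => ⟨v i, Metric.mem_ball_self (by norm_num)⟩)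
  intro i j hij
  refine Metric.ball_disjoint_ball ?_
  have h1 := norm_sub_sq (𝕜 := ℂ) (v i) (v j)
  rw [hv.2 hij, hv.1 i, hv.1 j, map_zero] at h1
  rw [dist_eq_norm]
  nlinarith [norm_nonneg (v i - v j)]

theorem exists_hilbertBasis_nat {E : Type*} [NormedAddCommGroup E] [InnerProductSpace ℂ E]
    [CompleteSpace E] [SeparableSpace E] (hE : ¬ FiniteDimensional ℂ E) :
    Nonempty (HilbertBasis ℕ ℂ E) := by
  obtain ⟨w, b, -⟩ := exists_hilbertBasis ℂ E
  have hc : Countable w := b.orthonormal.countable_index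
  have hi : Infinite w := by
    rw [← not_finite_iff_infinite]
    intro hf
    have := Fintype.ofFinite w
    exact hE b.toOrthonormalBasis.toBasis.finiteDimensional_of_finite
  obtain ⟨e⟩ := nonempty_equiv_of_countable (α := ℕ) (β := w)
  refine ⟨HilbertBasis.mk (v := b ∘ e) (b.orthonormal.comp e e.injective) ?_⟩
  rw [EquivLike.range_comp b e, b.dense_span]

theorem exists_linearIsometryEquiv {E F : Type*} [NormedAddCommGroup E] [InnerProductSpace ℂ E]
    [CompleteSpace E] [SeparableSpace E] [NormedAddCommGroup F] [InnerProductSpace ℂ F]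
    [CompleteSpace F] [SeparableSpace F] (hE : ¬ FiniteDimensional ℂ E)
    (hF : ¬ FiniteDimensional ℂ F) : Nonempty (E ≃ₗᵢ[ℂ] F) := by
  obtain ⟨b⟩ := exists_hilbertBasis_nat hE
  obtain ⟨c⟩ := exists_hilbertBasis_nat hF
  exact ⟨b.repr.trans c.repr.symm⟩

section

universe u

variable {H : Type u} [NormedAddCommGroup H] [InnerProductSpace ℂ H]

theorem exists_submodule_extDim_eq_natCast (hH : ¬ FiniteDimensional ℂ H) (k : ℕ) :
    ∃ N : Submodule ℂ H, FiniteDimensional ℂ N ∧ extDim N = k := by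
  obtain ⟨v, hv⟩ := natCast_le_extDim_iff.1 (extDim_eq_top_iff.2 hH ▸ le_top : (k : ℕ∞) ≤ extDim H)
  have hfin : FiniteDimensional ℂ (Submodule.span ℂ (range v)) :=
    FiniteDimensional.span_of_finite ℂ (finite_range v)
  refine ⟨Submodule.span ℂ (range v), hfin, ?_⟩
  rw [extDim_eq_finrank, finrank_span_eq_card hv, Fintype.card_fin]

theorem sigmaRank_nonempty (hH : ¬ FiniteDimensional ℂ H) (k : ℕ) : (sigmaRank H k).Nonempty := by
  obtain ⟨N, hN, hk⟩ := exists_submodule_extDim_eq_natCast hH k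
  refine ⟨N.starProjection, ?_⟩
  change extDim N.starProjection.range = k
  rw [Submodule.range_starProjection, hk]

theorem extDim_eq_top_of_linearIndependent {p : Submodule ℂ H} {v : ℕ → H}
    (hv : LinearIndependent ℂ v) (hp : ∀ i, v i ∈ p) : extDim p = ⊤ :=
  ENat.eq_top_iff_forall_ge.2 fun _ => natCast_le_extDim_submodule_iff.2
    ⟨fun i => v i, fun i => hp i, hv.comp _ Fin.val_injective⟩

variable [CompleteSpace H] [SeparableSpace H]

theorem exists_isClosed_submodule_extDim_eq (hH : ¬ FiniteDimensional ℂ H) (n : ℕ∞) :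
    ∃ N : Submodule ℂ H, IsClosed (N : Set H) ∧ extDim N = n ∧ ¬ FiniteDimensional ℂ Nᗮ := by
  induction n with
  | top =>
    obtain ⟨b⟩ := exists_hilbertBasis_nat hH
    have hli := b.orthonormal.linearIndependent
    -- The even basis vectors lie in `Nᗮ` and the odd ones in `N`.
    refine ⟨(Submodule.span ℂ (range fun i => b (2 * i)))ᗮ, Submodule.isClosed_orthogonal _, ?_, ?_⟩
    · refine extDim_eq_top_of_linearIndependent (v := fun i => b (2 * i + 1))
        (hli.comp (fun i => 2 * i + 1) fun i j h => by simpa using h) fun i => ?_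
      rw [Submodule.mem_orthogonal']
      intro u hu
      induction hu using Submodule.span_induction with
      | mem x hx =>
        obtain ⟨j, rfl⟩ := hx
        exact b.orthonormal.2 (by omega)
      | zero => exact inner_zero_right _
      | add x y _ _ hx hy => rw [inner_add_right, hx, hy, add_zero]
      | smul a x _ hx => rw [inner_smul_right, hx, mul_zero]
    · rw [← extDim_eq_top_iff]
      exact extDim_eq_top_of_linearIndependent (v := fun i => b (2 * i))
        (hli.comp (fun i => 2 * i) fun i j h => by simpa using h) fun i =>
        Submodule.le_orthogonal_orthogonal _ (Submodule.subset_span ⟨i, rfl⟩)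
  | coe k =>
    obtain ⟨N, hN, hk⟩ := exists_submodule_extDim_eq_natCast hH k
    refine ⟨N, N.closed_of_finiteDimensional, hk, fun h => hH ?_⟩
    have hsup : N ⊔ Nᗮ = ⊤ := Submodule.sup_orthogonal_of_hasOrthogonalProjection
    have : FiniteDimensional ℂ (⊤ : Submodule ℂ H) := hsup ▸ inferInstance
    exact Module.finite_def.2 (Module.Finite.iff_fg.1 this)

theorem exists_linearIsometry_extDim_orthogonal_range_eq (hH : ¬ FiniteDimensional ℂ H) (n : ℕ∞) :
    ∃ S : H →ₗᵢ[ℂ] H,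
      extDim ((S.toContinuousLinearMap.range)ᗮ : Submodule ℂ H) = n := by
  obtain ⟨N, hcl, hn, hinf⟩ := exists_isClosed_submodule_extDim_eq hH n
  have : CompleteSpace N := hcl.completeSpace_coe
  have : SeparableSpace Nᗮ := by
    have : SecondCountableTopology H := UniformSpace.secondCountable_of_separable H
    infer_instance
  obtain ⟨e⟩ := exists_linearIsometryEquiv hH hinf
  refine ⟨Nᗮ.subtypeₗᵢ.comp e.toLinearIsometry, ?_⟩
  have : (Nᗮ.subtypeₗᵢ.comp e.toLinearIsometry).toContinuousLinearMap.range = Nᗮ := by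
    ext x
    constructor
    · rintro ⟨y, rfl⟩
      exact (e y).2
    · intro hx
      exact ⟨e.symm ⟨x, hx⟩, by simp⟩
  rw [this, Submodule.orthogonal_orthogonal, hn]

/-- The diagonal operator with eigenvalues `2⁻ʲ` along an orthonormal basis. -/
theorem exists_injective_not_isClosed_range (hH : ¬ FiniteDimensional ℂ H) :
    ∃ D : H →L[ℂ] H, Function.Injective D ∧ Function.Injective (D†) ∧ ¬ IsClosed (range D) := by
  obtain ⟨b⟩ := exists_hilbertBasis_nat hH
  have hext : ∀ x y : H, (∀ j, ⟪b j, x⟫_ℂ = ⟪b j, y⟫_ℂ) → x = y := by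
    intro x y h
    apply b.repr.injective
    ext j
    rw [b.repr_apply_apply, b.repr_apply_apply, h]
  let t : ℕ → ℂ := fun i => ((1 / 2 : ℝ) ^ i : ℝ)
  have ht : ∀ j, t j ≠ 0 := fun j => Complex.ofReal_ne_zero.2 (by positivity)
  have htn : ∀ j, ‖t j‖ = (1 / 2 : ℝ) ^ j := fun j => by simp [t]
  have hsum : Summable fun i => t i • InnerProductSpace.rankOne ℂ (b i) (b i) := by
    refine Summable.of_norm ?_
    have h1 : ∀ i, ‖t i • InnerProductSpace.rankOne ℂ (b i) (b i)‖ = (1 / 2 : ℝ) ^ i := fun i => by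
      rw [norm_smul, htn, InnerProductSpace.norm_rankOne, b.orthonormal.1, mul_one, mul_one]
    simp only [h1]
    exact summable_geometric_two
  set D : H →L[ℂ] H := ∑' i, t i • InnerProductSpace.rankOne ℂ (b i) (b i) with hD
  have hinner : ∀ j x, ⟪b j, D x⟫_ℂ = t j * ⟪b j, x⟫_ℂ := by
    intro j x
    have h1 := hsum.hasSum.mapL ((innerSL ℂ (b j)) ∘L ContinuousLinearMap.apply ℂ H x)
    refine h1.unique ?_
    have h2 : ∀ i, ((innerSL ℂ (b j)) ∘L ContinuousLinearMap.apply ℂ H x)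
        (t i • InnerProductSpace.rankOne ℂ (b i) (b i)) = t i * (⟪b i, x⟫_ℂ * ⟪b j, b i⟫_ℂ) :=
      fun i => by simp
    have h3 : ⟪b j, b j⟫_ℂ = 1 := by simp [inner_self_eq_norm_sq_to_K, b.orthonormal.1]
    have h4 := hasSum_single (f := fun i => t i * (⟪b i, x⟫_ℂ * ⟪b j, b i⟫_ℂ)) j fun i hij => by
      rw [b.orthonormal.2 hij.symm, mul_zero, mul_zero]
    rw [h3, mul_one] at h4
    simpa only [h2] using! h4
  have hDb : ∀ j, D (b j) = t j • b j := by
    intro j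
    refine hext _ _ fun i => ?_
    rw [hinner, inner_smul_right]
    by_cases hij : i = j
    · rw [hij]
    · rw [b.orthonormal.2 hij, mul_zero, mul_zero]
  have hinner' : ∀ j x, ⟪b j, (D†) x⟫_ℂ = t j * ⟪b j, x⟫_ℂ := by
    intro j x
    rw [ContinuousLinearMap.adjoint_inner_right, hDb, inner_smul_left]
    rw [Complex.conj_ofReal]
  have hadj : D† = D := by
    ext x
    exact hext _ _ fun j => by rw [hinner, hinner']
  have hinj : Function.Injective D := by
    intro x y hxy
    refine hext _ _ fun j => mul_left_cancel₀ (ht j) ?_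
    rw [← hinner, ← hinner, hxy]
  refine ⟨D, hinj, hadj.symm ▸ hinj, fun hcl => ?_⟩
  obtain ⟨C, hC⟩ := (isClosed_range_iff_exists_norm_inner_le D).1 hcl
  -- Evaluating the criterion at `x = v = b j` gives `2⁻ʲ ≤ C * 2⁻ʲ * 2⁻ʲ` for all `j`.
  obtain ⟨j, hj⟩ := pow_unbounded_of_one_lt (C : ℝ) one_lt_two
  have h1 := hC (b j) (b j)
  rw [hadj, hDb, inner_smul_left, inner_self_eq_norm_sq_to_K, norm_smul, b.orthonormal.1, norm_mul,
    RCLike.norm_conj, htn] at h1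
  have hp : (0 : ℝ) < (1 / 2) ^ j := by positivity
  have hm : (1 / 2 : ℝ) ^ j * 2 ^ j = 1 := by rw [← mul_pow]; norm_num
  have h2 : (1 / 2 : ℝ) ^ j * 1 ≤ (1 / 2 : ℝ) ^ j * (C * (1 / 2 : ℝ) ^ j) := by
    simp at h1 ⊢
    linarith
  have h3 := le_of_mul_le_mul_left h2 hp
  nlinarith

/-- Kernel and cokernel dimensions are prescribed by two isometries, and the range is closed exactly
when the range of the middle factor is. -/
theorem exists_extDim_ker_eq_and_extDim_orthogonal_range_eq (hH : ¬ FiniteDimensional ℂ H)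
    (n m : ℕ∞) {D : H →L[ℂ] H} (hD : Function.Injective D) (hD' : Function.Injective (D†)) :
    ∃ A : H →L[ℂ] H, extDim A.ker = n ∧ extDim (A.rangeᗮ : Submodule ℂ H) = m ∧
      extDim A.range.topologicalClosure = ⊤ ∧ (IsClosed (range A) ↔ IsClosed (range D)) := by
  obtain ⟨S, hS⟩ := exists_linearIsometry_extDim_orthogonal_range_eq hH n
  obtain ⟨T, hT⟩ := exists_linearIsometry_extDim_orthogonal_range_eq hH m
  set S' := S.toContinuousLinearMap
  set T' := T.toContinuousLinearMap
  have hS' : ∀ x, (S'†) (S' x) = x := fun x => ext_inner_right ℂ fun y => by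
    rw [ContinuousLinearMap.adjoint_inner_left]
    exact S.inner_map_map x y
  have hTinj : Function.Injective T' := T.injective
  refine ⟨T' ∘L D ∘L S'†, ?_, ?_, ?_, ?_⟩
  · rw [← hS, S'.orthogonal_range]
    refine congrArg (fun p : Submodule ℂ H => extDim p) (Submodule.ext fun x => ?_)
    change T' (D ((S'†) x)) = 0 ↔ (S'†) x = 0
    rw [map_eq_zero_iff T' hTinj, map_eq_zero_iff D hD]
  · rw [← hT, T'.orthogonal_range, ContinuousLinearMap.orthogonal_range]
    refine congrArg (fun p : Submodule ℂ H => extDim p) (Submodule.ext fun x => ?_)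
    rw [ContinuousLinearMap.adjoint_comp, ContinuousLinearMap.adjoint_comp,
      ContinuousLinearMap.adjoint_adjoint]
    change S' ((D†) ((T'†) x)) = 0 ↔ (T'†) x = 0
    rw [map_eq_zero_iff S' S.injective, map_eq_zero_iff (D†) hD']
  · rw [extDim_topologicalClosure_eq_top_iff, ← top_le_iff, ← extDim_eq_top_iff.2 hH]
    refine extDim_le_of_injective
      (((T' ∘L D ∘L S'†) ∘L S').toLinearMap.codRestrict _ fun x => ⟨S' x, rfl⟩) ?_
    intro x y hxy
    have h1 : T' (D ((S'†) (S' x))) = T' (D ((S'†) (S' y))) := congrArg Subtype.val hxy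
    rw [hS', hS'] at h1
    exact hD (hTinj h1)
  · have h1 : range (T' ∘L D ∘L S'†) = T '' range D := by
      ext z
      constructor
      · rintro ⟨x, rfl⟩
        exact ⟨_, ⟨(S'†) x, rfl⟩, rfl⟩
      · rintro ⟨_, ⟨x, rfl⟩, rfl⟩
        refine ⟨S' x, ?_⟩
        change T' (D ((S'†) (S' x))) = T' (D x)
        rw [hS']
    rw [h1, ← T.isometry.isClosedEmbedding.isClosed_iff_image_isClosed]

theorem sigmaFamily_nonempty (hH : ¬ FiniteDimensional ℂ H) :
    ∀ i, (sigmaFamily H i).Nonempty := by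
  rintro (k | ⟨n, m⟩ | ⟨n, m⟩)
  · exact sigmaRank_nonempty hH k
  · have h1 : Function.Injective (ContinuousLinearMap.id ℂ H) := Function.injective_id
    obtain ⟨A, hn, hm, htop, hcl⟩ := exists_extDim_ker_eq_and_extDim_orthogonal_range_eq hH n m h1
      (by rwa [ContinuousLinearMap.adjoint_id])
    exact ⟨A, hn, hm, htop, hcl.2 (by simp)⟩
  · obtain ⟨D, hD, hD', hncl⟩ := exists_injective_not_isClosed_range hH
    obtain ⟨A, hn, hm, htop, hcl⟩ :=
      exists_extDim_ker_eq_and_extDim_orthogonal_range_eq hH n m hD hD'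
    exact ⟨A, hn, hm, htop, fun h => hncl (hcl.1 h)⟩

end

theorem mainTheorem5 (H : Type*) [NormedAddCommGroup H] [InnerProductSpace ℂ H]
    [CompleteSpace H] [SeparableSpace H] (hH : ¬ FiniteDimensional ℂ H) :
    -- the classes are nonempty, pairwise disjoint and cover `B(H)`
    ((∀ i, (sigmaFamily H i).Nonempty) ∧
      Pairwise (fun i j => Disjoint (sigmaFamily H i) (sigmaFamily H j)) ∧
      ⋃ i, sigmaFamily H i = Set.univ) ∧
    -- (a)
    (∀ k : ℕ, IsLocallyClosed (sigmaRank H k)) ∧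
    -- (b)
    (∀ n m : ℕ∞, n ≠ ⊤ ∨ m ≠ ⊤ → IsLocallyClosed (sigmaClosed H n m)) ∧
    (∀ n m : ℕ∞, n = 0 ∨ m = 0 → IsOpen (sigmaClosed H n m)) ∧
    -- (c)
    IsGδ (sigmaNonclosed H 0 0) ∧
    (∀ n m : ℕ∞, n ≠ ⊤ → m ≠ ⊤ → IsFsigmaInterGdelta (sigmaNonclosed H n m)) ∧
    (∀ n m : ℕ∞, (n = ⊤ ∧ m ≠ ⊤) ∨ (n ≠ ⊤ ∧ m = ⊤) →
      IsFsigmaDelta (sigmaNonclosed H n m)) ∧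
    -- (d)
    MeasurableSet[borel (H →L[ℂ] H)] (sigmaClosed H ⊤ ⊤) ∧
    MeasurableSet[borel (H →L[ℂ] H)] (sigmaNonclosed H ⊤ ⊤) := by
  borelize (H →L[ℂ] H)
  exact ⟨⟨sigmaFamily_nonempty hH, pairwise_disjoint_sigmaFamily, iUnion_sigmaFamily⟩,
    isLocallyClosed_sigmaRank,
    fun _ _ h => isLocallyClosed_sigmaClosed hH h,
    fun _ _ h => isOpen_sigmaClosed hH h,
    isGδ_sigmaNonclosed_zero_zero,
    fun _ _ hn hm => isFsigmaInterGdelta_sigmaNonclosed hn hm,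
    fun n m _ => isFsigmaDelta_sigmaNonclosed n m,
    (isFsigmaDelta_sigmaClosed ⊤ ⊤).measurableSet,
    (isFsigmaDelta_sigmaNonclosed ⊤ ⊤).measurableSet⟩
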